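/- Let $d$ be a nonnegative integer, let $(r_n)_{n\ge 0}$ be a sequence of positive real numbers, and let $(\omega_n)_{n\ge 0}$ be independent random points, each uniformly distributed in the unit cube $[0,1]^d\subset\mathbb{R}^d$. Let $$E=\limsup_{n} B(\omega_n,r_n)=\{x\in\mathbb{R}^d : |x-\omega_n|<r_n \text{ for infinitely many } n\},$$ where $|\cdot|$ is the Euclidean norm, and let $$t_0=\inf\Big\{t\ge 0 : \sum_{n} r_n^{\,t}<\infty\Big\}\in[0,\infty],\qquad \inf\emptyset=\infty .$$ Then, almost surely, the Hausdorff dimension of $E$ is $\min(t_0,d)$, and so is that of $E\cap[0,1]^d$ (the limsup set of the balls taken within the cube): $$\dim_{\mathrm H}E=\dim_{\mathrm H}\big(E\cap[0,1]^d\big)=\min(t_0,d).$$ -/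

import Mathlib

open MeasureTheory ProbabilityTheory Filter
open scoped ENNReal NNReal

/-- The unit cube `[0, 1]^d` in `d`-dimensional Euclidean space. -/
def unitCube (d : ℕ) : Set (EuclideanSpace ℝ (Fin d)) :=
  {x | ∀ i, x i ∈ Set.Icc (0 : ℝ) 1}

/-- The convergence exponent `t₀ = inf {t ≥ 0 | ∑ r_n ^ t < ∞}` of a sequence of positive numbers,
as an element of `[0, ∞]`; it is `∞` if the series diverges for every `t ≥ 0`. -/
noncomputable def convergenceExponent (r : ℕ → ℝ) : ℝ≥0∞ :=
  ⨅ (t : ℝ≥0) (_ : Summable fun n => r n ^ (t : ℝ)), (t : ℝ≥0∞)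

/-- The set of points covered by infinitely many of the open balls `B(c_n, r_n)`. -/
def limsupBalls {X : Type*} [PseudoMetricSpace X] (c : ℕ → X) (r : ℕ → ℝ) : Set X :=
  limsup (fun n => Metric.ball (c n) (r n)) atTop

/-! The upper bound is deterministic: tails of the balls cover `E`, and `∑ r_n ^ t < ∞` keeps its
`t`-dimensional Hausdorff measure finite.

For the lower bound take `θ < 1` with `d * θ < t₀`. Divergence of `∑ r_n ^ t` for some `t > d * θ`
yields, for `d * θ < t' < t`, infinitely many dyadic scales `R` with at least `R ^ (-t')` radii
above `R` (`frequently_rpow_le_card_of_not_summable`). By independence and a net argument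
(`measure_not_dense_le`), their centres fail to be `o(R ^ θ)`-dense with probability tending to 0,
so almost surely arbitrarily small good scales exist (`ae_forall_exists_scale`).

Given such scales, a small parameter cube is mapped into `E` by a map with `θ`-Hölder inverse
(`IsCantorScheme.dist_le`): the part of the parameter between meshes `R k ^ θ` and `R (k + 1) ^ θ`
is rescaled to fit in a ball of radius `R k`, then rounded to an available centre. Hence `dimH E ≥ d
* θ`. No lower bound on `R (k + 1) / R k` is needed. -/

theorem mem_limsupBalls {X : Type*} [PseudoMetricSpace X] {c : ℕ → X} {r : ℕ → ℝ} {x : X} :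
    x ∈ limsupBalls c r ↔ ∃ᶠ n in atTop, dist x (c n) < r n := by
  simp [limsupBalls, mem_limsup_iff_frequently_mem]

/-! ### Upper bound by the natural covers. -/

theorem dimH_limsupBalls_le_of_summable {X : Type*} [MetricSpace X] (c : ℕ → X) {r : ℕ → ℝ}
    (hr : ∀ n, 0 < r n) {t : ℝ≥0} (ht : Summable fun n => r n ^ (t : ℝ)) :
    dimH (limsupBalls c r) ≤ t := by
  have ht0 : 0 < (t : ℝ) := by
    rcases t.coe_nonneg.eq_or_lt with h | h
    · rw [← h] at ht
      simp [summable_const_iff] at ht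
    · exact h
  have hr0 : Tendsto r atTop (nhds 0) := by
    have h := ht.tendsto_atTop_zero.rpow_const (p := (t : ℝ)⁻¹) (Or.inr (by positivity))
    rw [Real.zero_rpow (by positivity)] at h
    refine h.congr fun n => ?_
    rw [← Real.rpow_mul (hr n).le, mul_inv_cancel₀ ht0.ne', Real.rpow_one]
  borelize X
  refine dimH_le_of_hausdorffMeasure_ne_top ?_
  set A : ℕ → ℝ≥0∞ := fun n => (2 * ENNReal.ofReal (r n)) ^ (t : ℝ)
  have hA : ∑' n, A n ≠ ∞ := by
    have h1 : A = fun n => (2 : ℝ≥0∞) ^ (t : ℝ) * ENNReal.ofReal (r n ^ (t : ℝ)) := by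
      funext n
      simp only [A]
      rw [ENNReal.mul_rpow_of_nonneg _ _ ht0.le,
        ENNReal.ofReal_rpow_of_nonneg (hr n).le ht0.le]
    rw [h1, ENNReal.tsum_mul_left]
    refine ENNReal.mul_ne_top (ENNReal.rpow_ne_top_of_nonneg ht0.le (by simp)) ?_
    exact ht.tsum_ofReal_ne_top
  set s : ℕ → ℝ≥0∞ := fun m => ⨆ n, 2 * ENNReal.ofReal (r (n + m))
  have hs : Tendsto s atTop (nhds 0) := by
    have h2 : Tendsto (fun n => 2 * ENNReal.ofReal (r n)) atTop (nhds 0) := by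
      simpa using ENNReal.Tendsto.const_mul (ENNReal.tendsto_ofReal hr0)
        (Or.inr (by simp : (2 : ℝ≥0∞) ≠ ∞))
    rw [ENNReal.tendsto_atTop_zero] at h2 ⊢
    intro ε hε
    obtain ⟨N, hN⟩ := h2 ε hε
    exact ⟨N, fun m hm => iSup_le fun n => hN _ (hm.trans (Nat.le_add_left _ _))⟩
  have hdiam : ∀ n, Metric.ediam (Metric.ball (c n) (r n)) ≤ 2 * ENNReal.ofReal (r n) := by
    intro n
    rw [← Metric.eball_ofReal]
    exact Metric.ediam_eball_le
  have key := Measure.hausdorffMeasure_le_liminf_tsum (β := ℕ) (ι := fun _ => ℕ) (t : ℝ)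
    (limsupBalls c r) (l := atTop) s hs
    (fun m n => Metric.ball (c (n + m)) (r (n + m)))
    (Eventually.of_forall fun m n =>
      (hdiam _).trans (le_iSup (fun n => 2 * ENNReal.ofReal (r (n + m))) n))
    (Eventually.of_forall fun m x hx => by
      obtain ⟨n, hn, hxn⟩ := (frequently_atTop.1 (mem_limsupBalls.1 hx)) m
      refine Set.mem_iUnion.2 ⟨n - m, ?_⟩
      rw [Nat.sub_add_cancel hn]
      exact hxn)
  refine ne_top_of_le_ne_top hA (key.trans ?_)
  refine liminf_le_of_frequently_le' (Frequently.of_forall fun m => ?_)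
  calc _ ≤ ∑' n, A (n + m) :=
        ENNReal.tsum_le_tsum fun n => ENNReal.rpow_le_rpow (hdiam _) ht0.le
    _ ≤ _ := ENNReal.tsum_comp_le_tsum_of_injective (add_left_injective m) A

theorem dimH_limsupBalls_le_convergenceExponent {X : Type*} [MetricSpace X] (c : ℕ → X)
    {r : ℕ → ℝ} (hr : ∀ n, 0 < r n) : dimH (limsupBalls c r) ≤ convergenceExponent r :=
  le_iInf₂ fun _ ht => dimH_limsupBalls_le_of_summable c hr ht

/-! ### Rounding to a grid, in the sup norm. -/

/-- Round each coordinate of `x` down to a multiple of `δ`. -/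
noncomputable def roundDown {d : ℕ} (δ : ℝ) (x : Fin d → ℝ) : Fin d → ℝ :=
  fun i => δ * ⌊x i / δ⌋

theorem roundDown_le {d : ℕ} {δ : ℝ} (hδ : 0 < δ) (x : Fin d → ℝ) (i : Fin d) :
    roundDown δ x i ≤ x i := by
  have := Int.floor_le (x i / δ)
  rw [le_div_iff₀ hδ] at this
  unfold roundDown
  linarith

theorem lt_roundDown_add {d : ℕ} {δ : ℝ} (hδ : 0 < δ) (x : Fin d → ℝ) (i : Fin d) :
    x i < roundDown δ x i + δ := by
  have := Int.lt_floor_add_one (x i / δ)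
  rw [div_lt_iff₀ hδ] at this
  unfold roundDown
  linarith

theorem dist_roundDown_roundDown_le {d : ℕ} {δ δ' : ℝ} (hδ : 0 < δ) (h : δ ≤ δ')
    (x : Fin d → ℝ) : dist (roundDown δ x) (roundDown δ' x) ≤ δ' := by
  refine (dist_pi_le_iff (hδ.le.trans h)).2 fun i => ?_
  have h1 := roundDown_le hδ x i
  have h2 := lt_roundDown_add hδ x i
  have h3 := roundDown_le (hδ.trans_le h) x i
  have h4 := lt_roundDown_add (hδ.trans_le h) x i
  rw [Real.dist_eq, abs_le]
  constructor <;> linarith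

theorem dist_le_dist_roundDown_add {d : ℕ} {δ : ℝ} (hδ : 0 < δ) (x y : Fin d → ℝ) :
    dist x y ≤ dist (roundDown δ x) (roundDown δ y) + δ := by
  refine (dist_pi_le_iff (by positivity)).2 fun i => ?_
  have h0 := dist_le_pi_dist (roundDown δ x) (roundDown δ y) i
  rw [Real.dist_eq, abs_le] at *
  have h1 := roundDown_le hδ x i
  have h2 := lt_roundDown_add hδ x i
  have h3 := roundDown_le hδ y i
  have h4 := lt_roundDown_add hδ y i
  constructor <;> linarith

theorem le_dist_roundDown_of_ne {d : ℕ} {δ : ℝ} (hδ : 0 < δ) {x y : Fin d → ℝ}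
    (h : roundDown δ x ≠ roundDown δ y) : δ ≤ dist (roundDown δ x) (roundDown δ y) := by
  obtain ⟨i, hi⟩ := Function.ne_iff.1 h
  refine le_trans ?_ (dist_le_pi_dist _ _ i)
  simp only [roundDown, ne_eq, mul_eq_mul_left_iff, hδ.ne', or_false, Int.cast_inj] at hi ⊢
  rw [Real.dist_eq, ← mul_sub, abs_mul, abs_of_pos hδ, ← Int.cast_sub, ← Int.cast_abs]
  have : (1 : ℝ) ≤ (|⌊x i / δ⌋ - ⌊y i / δ⌋| : ℤ) := by
    exact_mod_cast Int.one_le_abs (sub_ne_zero.2 hi)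
  nlinarith

theorem roundDown_eq_zero {d : ℕ} {δ : ℝ} (hδ : 0 < δ) {x : Fin d → ℝ}
    (h : ∀ i, x i ∈ Set.Ico 0 δ) : roundDown δ x = 0 := by
  funext i
  have : ⌊x i / δ⌋ = 0 := by
    rw [Int.floor_eq_zero_iff]
    exact ⟨div_nonneg (h i).1 hδ.le, (div_lt_one hδ).2 (h i).2⟩
  simp [roundDown, this]

/-! ### The Cantor construction and its dimension. -/

/-- The successive approximations of a point of a Cantor set inside a limsup set: the `k`-th step
moves by a multiple of the difference of the roundings of the parameter `x` at two consecutive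
scales `R k ^ θ`, followed by a rounding `φ (k + 1)` to the set of available centres. -/
noncomputable def cantorApprox {d : ℕ} (θ : ℝ) (R : ℕ → ℝ)
    (φ : ℕ → (Fin d → ℝ) → (Fin d → ℝ)) (x : Fin d → ℝ) : ℕ → Fin d → ℝ
  | 0 => fun _ => 1 / 2
  | k + 1 => φ (k + 1) (cantorApprox θ R φ x k +
      (R k ^ (1 - θ) / 4) • (roundDown (R (k + 1) ^ θ) x - roundDown (R k ^ θ) x))

theorem cantorApprox_congr {d : ℕ} {θ : ℝ} {R : ℕ → ℝ} {φ : ℕ → (Fin d → ℝ) → (Fin d → ℝ)}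
    {x y : Fin d → ℝ} {k : ℕ} (h : ∀ i ≤ k, roundDown (R i ^ θ) x = roundDown (R i ^ θ) y) :
    cantorApprox θ R φ x k = cantorApprox θ R φ y k := by
  induction k with
  | zero => rfl
  | succ k ih =>
    simp only [cantorApprox]
    rw [ih fun i hi => h i (hi.trans k.le_succ), h k k.le_succ, h (k + 1) le_rfl]

/-- The data needed to run the construction `cantorApprox` inside `limsupBalls c ρ`. -/
structure IsCantorScheme {d : ℕ} (θ : ℝ) (R : ℕ → ℝ) (φ : ℕ → (Fin d → ℝ) → (Fin d → ℝ)) :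
    Prop where
  θ_pos : 0 < θ
  θ_lt : θ < 1
  R_zero : R 0 = 1 / 2
  R_pos : ∀ k, 0 < R k
  R_anti : ∀ k, R (k + 1) ≤ R k
  R_small : ∀ k, R (k + 1) < 1 / (k + 1)
  R_le : ∀ k, R (k + 1) ≤ R k ^ (1 - θ) / 32 * R (k + 1) ^ θ
  dist_φ_le : ∀ k, ∀ y ∈ Set.Icc (0 : Fin d → ℝ) 1,
    dist (φ (k + 1) y) y ≤ R k ^ (1 - θ) / 32 * R (k + 1) ^ θ

namespace IsCantorScheme

variable {d : ℕ} {θ : ℝ} {R : ℕ → ℝ} {φ : ℕ → (Fin d → ℝ) → (Fin d → ℝ)}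

theorem target_mem (h : IsCantorScheme θ R φ) {g x : Fin d → ℝ} {k : ℕ}
    (hg : Metric.closedBall g (R k) ⊆ Set.Icc 0 1) :
    dist (g + (R k ^ (1 - θ) / 4) • (roundDown (R (k + 1) ^ θ) x - roundDown (R k ^ θ) x)) g
      ≤ R k / 4 ∧
    g + (R k ^ (1 - θ) / 4) • (roundDown (R (k + 1) ^ θ) x - roundDown (R k ^ θ) x)
      ∈ Set.Icc (0 : Fin d → ℝ) 1 := by
  have hR := h.R_pos k
  have h1 : dist (g + (R k ^ (1 - θ) / 4) •
      (roundDown (R (k + 1) ^ θ) x - roundDown (R k ^ θ) x)) g ≤ R k / 4 := by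
    rw [dist_self_add_left, norm_smul, ← dist_eq_norm, Real.norm_of_nonneg (by positivity)]
    calc _ ≤ R k ^ (1 - θ) / 4 * R k ^ θ := by
          gcongr
          exact dist_roundDown_roundDown_le (Real.rpow_pos_of_pos (h.R_pos _) _)
            (Real.rpow_le_rpow (h.R_pos _).le (h.R_anti k) h.θ_pos.le) x
      _ = R k / 4 := by
          rw [div_mul_eq_mul_div, ← Real.rpow_add hR]
          simp
  exact ⟨h1, hg (by rw [Metric.mem_closedBall]; linarith)⟩

theorem mul_rpow_le (h : IsCantorScheme θ R φ) (k : ℕ) :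
    R k ^ (1 - θ) / 32 * R (k + 1) ^ θ ≤ R k / 32 := by
  have hR := h.R_pos k
  calc _ ≤ R k ^ (1 - θ) / 32 * R k ^ θ := by
        gcongr
        · exact (h.R_pos _).le
        · exact h.θ_pos.le
        · exact h.R_anti k
    _ = R k / 32 := by
        rw [div_mul_eq_mul_div, ← Real.rpow_add hR]
        simp

/-- The move costs at most `R k / 4`, and the rounding and the new radius at most `R k / 32` each.
Containment in the cube is carried through the induction because `dist_φ_le` controls the rounding
only there. -/
theorem closedBall_subset (h : IsCantorScheme θ R φ) (x : Fin d → ℝ) (k : ℕ) :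
    Metric.closedBall (cantorApprox θ R φ x (k + 1)) (R (k + 1)) ⊆
        Metric.closedBall (cantorApprox θ R φ x k) (R k) ∧
      Metric.closedBall (cantorApprox θ R φ x k) (R k) ⊆ Set.Icc 0 1 := by
  have step : ∀ k, Metric.closedBall (cantorApprox θ R φ x k) (R k) ⊆ Set.Icc 0 1 →
      Metric.closedBall (cantorApprox θ R φ x (k + 1)) (R (k + 1)) ⊆
        Metric.closedBall (cantorApprox θ R φ x k) (R k) := by
    intro k hk
    obtain ⟨h1, h2⟩ := h.target_mem (x := x) hk
    have h3 := h.dist_φ_le k _ h2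
    have h4 := h.mul_rpow_le k
    have h5 := h.R_le k
    have h6 := h.R_pos k
    refine Metric.closedBall_subset_closedBall' ?_
    have h7 := dist_triangle (cantorApprox θ R φ x (k + 1)) _ (cantorApprox θ R φ x k) |>.trans
      (add_le_add h3 h1)
    linarith
  suffices hcube : ∀ k, Metric.closedBall (cantorApprox θ R φ x k) (R k) ⊆ Set.Icc 0 1 from
    ⟨step k (hcube k), hcube k⟩
  intro k
  induction k with
  | zero =>
    rw [h.R_zero]
    intro y hy
    rw [Metric.mem_closedBall, dist_pi_le_iff (by norm_num)] at hy
    simp only [cantorApprox, Real.dist_eq, abs_le] at hy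
    exact ⟨fun i => by have := hy i; simp; linarith, fun i => by have := hy i; simp; linarith⟩
  | succ k ih => exact (step k ih).trans ih

theorem exists_limit (h : IsCantorScheme θ R φ) (x : Fin d → ℝ) :
    ∃ z, ∀ k, dist z (cantorApprox θ R φ x k) ≤ R k := by
  obtain ⟨z, hz⟩ := IsCompact.nonempty_iInter_of_sequence_nonempty_isCompact_isClosed
    (fun k => Metric.closedBall (cantorApprox θ R φ x k) (R k))
    (fun k => (h.closedBall_subset x k).1)
    (fun k => Metric.nonempty_closedBall.2 (h.R_pos k).le)
    (isCompact_closedBall _ _) (fun _ => Metric.isClosed_closedBall)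
  exact ⟨z, fun k => Set.mem_iInter.1 hz k⟩

theorem tendsto_rpow (h : IsCantorScheme θ R φ) : Tendsto (fun k => R k ^ θ) atTop (nhds 0) := by
  have h1 : Tendsto (fun k => R (k + 1)) atTop (nhds 0) :=
    squeeze_zero (fun k => (h.R_pos _).le) (fun k => (h.R_small k).le)
      tendsto_one_div_add_atTop_nhds_zero_nat
  have h2 := ((tendsto_add_atTop_iff_nat 1).1 h1).rpow_const (p := θ) (Or.inr h.θ_pos.le)
  rwa [Real.zero_rpow h.θ_pos.ne'] at h2

/-- The limit points of the construction depend on the parameter in an expanding way. -/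
theorem dist_le (h : IsCantorScheme θ R φ) {g : (Fin d → ℝ) → (Fin d → ℝ)}
    (hg : ∀ x k, dist (g x) (cantorApprox θ R φ x k) ≤ R k) {x y : Fin d → ℝ}
    (hx : ∀ i, x i ∈ Set.Ico 0 (R 0 ^ θ)) (hy : ∀ i, y i ∈ Set.Ico 0 (R 0 ^ θ)) :
    dist x y ≤ 16 ^ θ * dist (g x) (g y) ^ θ := by
  have hθ := h.θ_pos
  have hpos : ∀ k, 0 < R k ^ θ := fun k => Real.rpow_pos_of_pos (h.R_pos k) _
  rcases eq_or_ne x y with rfl | hxy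
  · rw [dist_self]
    positivity
  have hex : ∃ k, roundDown (R k ^ θ) x ≠ roundDown (R k ^ θ) y := by
    by_contra! hcon
    have h1 : ∀ k, dist x y ≤ R k ^ θ := fun k => by
      have := dist_le_dist_roundDown_add (hpos k) x y
      rwa [hcon k, dist_self, zero_add] at this
    exact absurd (ge_of_tendsto' h.tendsto_rpow h1) (not_le.2 (dist_pos.2 hxy))
  classical
  obtain ⟨k, hk⟩ : ∃ k, Nat.find hex = k + 1 := by
    -- Both parameters lie in one cell of mesh `R 0 ^ θ`, so they cannot separate at scale 0.
    refine Nat.exists_eq_succ_of_ne_zero fun h0 => ?_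
    have := Nat.find_spec hex
    rw [h0, roundDown_eq_zero (hpos 0) hx, roundDown_eq_zero (hpos 0) hy] at this
    exact this rfl
  have hne := Nat.find_spec hex
  have heq : ∀ i ≤ k, roundDown (R i ^ θ) x = roundDown (R i ^ θ) y := fun i hi => by
    have := Nat.find_min hex (m := i) (by omega)
    rwa [not_not] at this
  rw [hk] at hne
  set κ := R k ^ (1 - θ) / 32 with hκ
  have hR := h.R_pos k
  have hκ0 : 0 < κ := by positivity
  set Δ := dist (roundDown (R (k + 1) ^ θ) x) (roundDown (R (k + 1) ^ θ) y)
  have hΔ : R (k + 1) ^ θ ≤ Δ := le_dist_roundDown_of_ne (hpos _) hne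
  have hxyΔ : dist x y ≤ 2 * Δ := by
    have := dist_le_dist_roundDown_add (hpos (k + 1)) x y
    linarith
  have hxyk : dist x y ≤ R k ^ θ := by
    have := dist_le_dist_roundDown_add (hpos k) x y
    rwa [heq k le_rfl, dist_self, zero_add] at this
  have hstep : ∀ x, dist (cantorApprox θ R φ x (k + 1)) (cantorApprox θ R φ x k +
      (R k ^ (1 - θ) / 4) • (roundDown (R (k + 1) ^ θ) x - roundDown (R k ^ θ) x))
      ≤ κ * R (k + 1) ^ θ := fun x =>
    h.dist_φ_le k _ (h.target_mem (h.closedBall_subset x k).2).2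
  have htarget : dist (cantorApprox θ R φ x k +
      (R k ^ (1 - θ) / 4) • (roundDown (R (k + 1) ^ θ) x - roundDown (R k ^ θ) x))
      (cantorApprox θ R φ y k +
      (R k ^ (1 - θ) / 4) • (roundDown (R (k + 1) ^ θ) y - roundDown (R k ^ θ) y)) = 8 * κ * Δ := by
    rw [cantorApprox_congr heq, heq k le_rfl, dist_add_left, dist_smul₀, dist_sub_right,
      Real.norm_of_nonneg (by positivity), hκ]
    ring
  have hR1 : R (k + 1) ≤ κ * R (k + 1) ^ θ := h.R_le k
  -- The targets are `8 * κ * Δ` apart; two roundings and two passages to the limit lose at most `κ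
  -- * Δ` each.
  have hlow : 4 * κ * Δ ≤ dist (g x) (g y) := by
    have h1 := hg x (k + 1)
    have h2 := hg y (k + 1)
    have h3 := hstep x
    have h4 := hstep y
    rw [dist_comm] at h1 h3
    have h5 := dist_triangle4 _ (cantorApprox θ R φ x (k + 1)) (cantorApprox θ R φ y (k + 1)) _
      |>.trans' htarget.ge
    have h6 := dist_triangle4 (cantorApprox θ R φ x (k + 1)) (g x) (g y)
      (cantorApprox θ R φ y (k + 1))
    have h7 : κ * R (k + 1) ^ θ ≤ κ * Δ := by gcongr
    linarith
  have hroot : dist x y ^ θ⁻¹ ≤ R k := by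
    calc _ ≤ (R k ^ θ) ^ θ⁻¹ := by gcongr
      _ = R k := by rw [← Real.rpow_mul hR.le, mul_inv_cancel₀ hθ.ne', Real.rpow_one]
  have hfinal : dist x y ^ θ⁻¹ ≤ 16 * dist (g x) (g y) := by
    -- Interpolation between the two bounds on `dist x y`: `2 * Δ` from the mesh that separates the
    -- parameters, `R k ^ θ` from the last mesh that does not.
    calc dist x y ^ θ⁻¹ = dist x y * (dist x y ^ θ⁻¹) ^ (1 - θ) := by
          rw [← Real.rpow_mul dist_nonneg, mul_sub, mul_one, inv_mul_cancel₀ hθ.ne',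
            Real.rpow_sub_one (dist_pos.2 hxy).ne', mul_div_cancel₀ _ (dist_pos.2 hxy).ne']
      _ ≤ 2 * Δ * R k ^ (1 - θ) := by
          gcongr
          linarith [h.θ_lt]
      _ = 16 * (4 * κ * Δ) := by rw [hκ]; ring
      _ ≤ _ := by gcongr
  calc dist x y = (dist x y ^ θ⁻¹) ^ θ := by
        rw [← Real.rpow_mul dist_nonneg, inv_mul_cancel₀ hθ.ne', Real.rpow_one]
    _ ≤ (16 * dist (g x) (g y)) ^ θ := by gcongr
    _ = _ := Real.mul_rpow (by norm_num) dist_nonneg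

/-- The parameter cell `T` has dimension `d` and is the image of `g '' T` under a `θ`-Hölder map,
which multiplies dimension by at most `1 / θ`. -/
theorem le_dimH (h : IsCantorScheme θ R φ) {E : Set (Fin d → ℝ)}
    (hE : ∀ x z, (∀ k, dist z (cantorApprox θ R φ x k) ≤ R k) → z ∈ E) :
    ENNReal.ofReal (d * θ) ≤ dimH E := by
  choose g hg using h.exists_limit
  have hpos : 0 < R 0 ^ θ := Real.rpow_pos_of_pos (h.R_pos 0) _
  set T : Set (Fin d → ℝ) := {x | ∀ i, x i ∈ Set.Ico 0 (R 0 ^ θ)}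
  have hdist : ∀ x ∈ T, ∀ y ∈ T, dist x y ≤ 16 ^ θ * dist (g x) (g y) ^ θ :=
    fun x hx y hy => h.dist_le hg hx hy
  have hinj : Set.InjOn g T := fun x hx y hy hxy => by
    have := hdist x hx y hy
    rw [hxy, dist_self, Real.zero_rpow h.θ_pos.ne', mul_zero] at this
    exact dist_le_zero.1 this
  have hT : dimH T = d := by
    have : (interior T).Nonempty := by
      refine ⟨fun _ => R 0 ^ θ / 2, mem_interior.2
        ⟨Set.univ.pi fun _ => Set.Ioo 0 (R 0 ^ θ), fun x hx i => ?_,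
          isOpen_set_pi Set.finite_univ fun _ _ => isOpen_Ioo, fun i _ => ⟨?_, ?_⟩⟩⟩
      · exact Set.Ioo_subset_Ico_self (hx i trivial)
      · exact half_pos hpos
      · exact half_lt_self hpos
    rw [Real.dimH_of_nonempty_interior this]
    simp
  have hleft := hinj.leftInvOn_invFunOn
  have hholder : HolderOnWith (16 ^ θ) θ.toNNReal (Function.invFunOn g T) (g '' T) := by
    rintro _ ⟨x, hx, rfl⟩ _ ⟨y, hy, rfl⟩
    rw [hleft hx, hleft hy, edist_nndist, edist_nndist, Real.coe_toNNReal _ h.θ_pos.le,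
      ← ENNReal.coe_rpow_of_nonneg _ h.θ_pos.le, ← ENNReal.coe_mul, ENNReal.coe_le_coe,
      ← NNReal.coe_le_coe]
    simpa using hdist x hx y hy
  have hdim := hholder.dimH_image_le (Real.toNNReal_pos.2 h.θ_pos)
  rw [hleft.image_image, hT, ENNReal.le_div_iff_mul_le
    (Or.inl (by simpa using h.θ_pos)) (Or.inl ENNReal.coe_ne_top)] at hdim
  calc ENNReal.ofReal (d * θ) = d * ENNReal.ofReal θ := by
        rw [ENNReal.ofReal_mul (by positivity), ENNReal.ofReal_natCast]
    _ ≤ dimH (g '' T) := hdim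
    _ ≤ dimH E := dimH_mono (by
        rintro _ ⟨x, -, rfl⟩
        exact hE x _ (hg x))

end IsCantorScheme

/-! ### Choosing the scales and centres. -/

/-- If at arbitrarily small scales `R` the centres of the balls of radius larger than `R` are
`o(R ^ θ)`-dense in the unit cube, then the limsup set has dimension at least `d * θ` there. -/
theorem le_dimH_limsupBalls_inter {d : ℕ} {θ : ℝ} (hθ0 : 0 < θ) (hθ1 : θ < 1)
    {c : ℕ → Fin d → ℝ} {ρ : ℕ → ℝ}
    (H : ∀ k : ℕ, ∃ R : ℝ, 0 < R ∧ R < 1 / (k + 1) ∧ ∀ y ∈ Set.Icc (0 : Fin d → ℝ) 1,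
      ∃ n, k ≤ n ∧ R < ρ n ∧ dist (c n) y ≤ R ^ θ / (k + 1)) :
    ENNReal.ofReal (d * θ) ≤ dimH (limsupBalls c ρ ∩ Set.Icc 0 1) := by
  have next : ∀ (k : ℕ) (S : ℝ), 0 < S → ∃ R, 0 < R ∧ R ≤ S ∧ R < 1 / (k + 1) ∧
      R ≤ S ^ (1 - θ) / 32 * R ^ θ ∧ ∀ y ∈ Set.Icc (0 : Fin d → ℝ) 1,
      ∃ n, k ≤ n ∧ R < ρ n ∧ dist (c n) y ≤ S ^ (1 - θ) / 32 * R ^ θ := by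
    intro k S hS
    have hlim : Tendsto (fun m : ℕ => (1 : ℝ) / (m + 1)) atTop (nhds 0) :=
      tendsto_one_div_add_atTop_nhds_zero_nat
    have hlim' := hlim.rpow_const (p := 1 - θ) (Or.inr (by linarith))
    rw [Real.zero_rpow (by linarith)] at hlim'
    have hκ : 0 < S ^ (1 - θ) / 32 := by positivity
    -- The factor `1 / (m + 1)` in the density hypothesis absorbs the constant `S ^ (1 - θ) / 32`,
    -- which depends on the previous scale; `hm3` gives `R = R ^ (1 - θ) * R ^ θ` the same bound.
    obtain ⟨m, ⟨⟨hm1, hm2⟩, hm3⟩, hm4⟩ := (((hlim.eventually (gt_mem_nhds hS)).and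
      (hlim.eventually (gt_mem_nhds hκ))).and (hlim'.eventually (gt_mem_nhds hκ))).and
      (eventually_ge_atTop k) |>.exists
    obtain ⟨R, hR0, hRm, hR⟩ := H m
    have hsplit : R = R ^ (1 - θ) * R ^ θ := by rw [← Real.rpow_add hR0]; simp
    refine ⟨R, hR0, (hRm.trans hm1).le, hRm.trans_le (by gcongr), ?_, fun y hy => ?_⟩
    · calc R = R ^ (1 - θ) * R ^ θ := hsplit
        _ ≤ _ := by
          gcongr
          exact (Real.rpow_le_rpow hR0.le hRm.le (by linarith)).trans hm3.le
    · obtain ⟨n, hn1, hn2, hn3⟩ := hR y hy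
      refine ⟨n, hm4.trans hn1, hn2, hn3.trans ?_⟩
      rw [div_eq_mul_one_div, mul_comm]
      gcongr
  choose! F hF0 hFS hFk hFle hFdense using next
  let R : ℕ → ℝ := fun k => Nat.rec (1 / 2) (fun k S => F k S) k
  have hRpos : ∀ k, 0 < R k := fun k => by
    induction k with
    | zero => norm_num [R]
    | succ k ih => exact hF0 k _ ih
  have hdense : ∀ k, ∀ y ∈ Set.Icc (0 : Fin d → ℝ) 1, ∃ n, k ≤ n ∧ R (k + 1) < ρ n ∧
      dist (c n) y ≤ R k ^ (1 - θ) / 32 * R (k + 1) ^ θ := fun k => hFdense k _ (hRpos k)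
  choose! ν hν1 hν2 hν3 using hdense
  have h : IsCantorScheme θ R fun k y => c (ν (k - 1) y) :=
    { θ_pos := hθ0
      θ_lt := hθ1
      R_zero := rfl
      R_pos := hRpos
      R_anti := fun k => hFS k _ (hRpos k)
      R_small := fun k => hFk k _ (hRpos k)
      R_le := fun k => hFle k _ (hRpos k)
      dist_φ_le := fun k y hy => hν3 k y hy }
  refine h.le_dimH fun x z hz => ⟨mem_limsupBalls.2 (frequently_atTop.2 fun k => ?_), ?_⟩
  · have hy := (h.target_mem (x := x) (h.closedBall_subset x k).2).2
    exact ⟨_, hν1 k _ hy, (hz (k + 1)).trans_lt (hν2 k _ hy)⟩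
  · exact (h.closedBall_subset x 0).2 (hz 0)

/-! ### Counting large radii at dyadic scales. -/

/-- If `∑ a n ^ t` diverges and `t' < t`, then at arbitrarily small dyadic scales `2⁻ʲ` at least
`2 ^ (j * t')` of the terms exceed `2⁻ʲ`, even if finitely many terms are discarded. -/
theorem frequently_rpow_le_card_of_not_summable {a : ℕ → ℝ} (ha : ∀ n, 0 < a n) {t t' : ℝ}
    (ht' : 0 < t') (htt' : t' < t) (hsum : ¬ Summable fun n => a n ^ t) (N : ℕ) :
    ∃ᶠ j : ℕ in atTop, ∃ I : Finset ℕ, (∀ n ∈ I, N ≤ n ∧ (1 / 2 : ℝ) ^ j < a n) ∧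
      ((1 / 2 : ℝ) ^ j) ^ (-t') ≤ I.card := by
  intro hev
  obtain ⟨j₀, hj₀⟩ := eventually_atTop.1 hev
  push Not at hj₀
  apply hsum
  rw [← summable_nat_add_iff N]
  set b : ℕ → ℝ := fun n => a (n + N)
  have hb : ∀ n, 0 < b n := fun n => ha _
  set S : ℕ → Set ℕ := fun j => {n | (1 / 2 : ℝ) ^ j < b n}
  have hcard : ∀ j, j₀ ≤ j → ∀ I : Finset ℕ, (I : Set ℕ) ⊆ S j →
      (I.card : ℝ) < ((1 / 2 : ℝ) ^ j) ^ (-t') := by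
    intro j hj I hI
    have := hj₀ j hj (I.map (addRightEmbedding N)) (by
      intro n hn
      obtain ⟨m, hm, rfl⟩ := Finset.mem_map.1 hn
      exact ⟨Nat.le_add_left _ _, hI hm⟩)
    rwa [Finset.card_map] at this
  have hfin : ∀ j, j₀ ≤ j → (S j).Finite := by
    intro j hj
    by_contra hinf
    obtain ⟨I, hI, hIc⟩ := Set.Infinite.exists_subset_card_eq hinf
      ⌈((1 / 2 : ℝ) ^ j) ^ (-t')⌉₊
    have := hcard j hj I hI
    rw [hIc] at this
    exact absurd (Nat.le_ceil _) (not_le.2 this)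
  have hsmall : Summable fun n => (S j₀)ᶜ.indicator (fun n => b n ^ t) n := by
    -- Dyadic shells: a term in `(2⁻ʲ⁻¹, 2⁻ʲ]` is at most `2⁻ʲ`, and fewer than `2 ^ ((j + 1) * t')`
    -- terms exceed `2⁻ʲ⁻¹`. The sum over `j` is then dominated by a geometric series of ratio `2 ^
    -- (t' - t)`.
    set F : ℕ → ℕ → ℝ≥0∞ := fun k n =>
      (S (j₀ + k + 1)).indicator (fun _ => ENNReal.ofReal (((1 / 2 : ℝ) ^ (j₀ + k)) ^ t)) n
    have hle : ∀ n, ENNReal.ofReal ((S j₀)ᶜ.indicator (fun n => b n ^ t) n) ≤ ∑' k, F k n := by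
      intro n
      by_cases hn : n ∈ S j₀
      · simp [hn]
      rw [Set.indicator_of_mem (show n ∈ (S j₀)ᶜ from hn)]
      have hex : ∃ k, (1 / 2 : ℝ) ^ (j₀ + k + 1) < b n := by
        obtain ⟨k, hk⟩ := exists_pow_lt_of_lt_one (hb n) (by norm_num : (1 / 2 : ℝ) < 1)
        exact ⟨k, (pow_le_pow_of_le_one (by norm_num) (by norm_num) (by omega)).trans_lt hk⟩
      classical
      have h1 := Nat.find_spec hex
      have h2 : b n ≤ (1 / 2 : ℝ) ^ (j₀ + Nat.find hex) := by
        rcases Nat.eq_zero_or_eq_succ_pred (Nat.find hex) with h0 | h0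
        · rw [h0]
          exact not_lt.1 hn
        · rw [h0]
          exact not_lt.1 (Nat.find_min hex (m := (Nat.find hex).pred) (by omega))
      refine le_trans ?_ (ENNReal.le_tsum (Nat.find hex))
      simp only [F]
      rw [Set.indicator_of_mem (show n ∈ S _ from h1)]
      exact ENNReal.ofReal_le_ofReal (Real.rpow_le_rpow (hb n).le h2 (by linarith))
    have hFk : ∀ k, ∑' n, F k n ≤
        ENNReal.ofReal (2 ^ t' * ((1 / 2 : ℝ) ^ (t - t')) ^ (j₀ + k)) := by
      intro k
      have hf := hfin (j₀ + k + 1) (by omega)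
      have hc := hcard (j₀ + k + 1) (by omega) hf.toFinset (by simp)
      rw [tsum_eq_sum (s := hf.toFinset) (fun n hn => Set.indicator_of_notMem (by simpa using hn) _),
        Finset.sum_congr rfl fun n hn => Set.indicator_of_mem (hf.mem_toFinset.1 hn) _,
        Finset.sum_const, nsmul_eq_mul, ← ENNReal.ofReal_natCast, ← ENNReal.ofReal_mul (by positivity)]
      refine ENNReal.ofReal_le_ofReal ?_
      calc _ ≤ ((1 / 2 : ℝ) ^ (j₀ + k + 1)) ^ (-t') * ((1 / 2 : ℝ) ^ (j₀ + k)) ^ t := by gcongr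
        _ = _ := by
          have hhalf : (1 / 2 : ℝ) ^ (-t') = 2 ^ t' := by
            rw [one_div, Real.inv_rpow (by norm_num), Real.rpow_neg (by norm_num), inv_inv]
          rw [pow_succ, Real.mul_rpow (by positivity) (by norm_num), hhalf,
            Real.rpow_pow_comm (by norm_num), sub_eq_add_neg, Real.rpow_add (by positivity)]
          ring
    have htop : ∑' n, ENNReal.ofReal ((S j₀)ᶜ.indicator (fun n => b n ^ t) n) ≠ ∞ := by
      refine ne_top_of_le_ne_top ?_ ((ENNReal.tsum_le_tsum hle).trans
        (ENNReal.tsum_comm.le.trans (ENNReal.tsum_le_tsum hFk)))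
      refine Summable.tsum_ofReal_ne_top (Summable.mul_left _ ?_)
      simp_rw [pow_add]
      refine Summable.mul_left _ (summable_geometric_of_lt_one (by positivity) ?_)
      exact Real.rpow_lt_one (by norm_num) (by norm_num) (by linarith)
    have := ENNReal.summable_toReal htop
    refine this.congr fun n => ENNReal.toReal_ofReal ?_
    exact Set.indicator_nonneg (fun n _ => (Real.rpow_pos_of_pos (hb n) _).le) _
  refine hsmall.congr_cofinite ?_
  filter_upwards [(hfin j₀ le_rfl).compl_mem_cofinite] with n hn
  exact Set.indicator_of_mem hn _

/-! ### Density of the random centres. -/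

theorem ofReal_pow_le_volume_closedBall_inter {d : ℕ} {ε : ℝ} (hε0 : 0 < ε) (hε1 : ε ≤ 1)
    {y : Fin d → ℝ} (hy : y ∈ Set.Icc (0 : Fin d → ℝ) 1) :
    ENNReal.ofReal (ε ^ d) ≤ volume (Metric.closedBall y ε ∩ Set.Icc 0 1) := by
  -- Lower corner of a cube of side `ε` containing `y`, pushed back inside the unit cube.
  set u : Fin d → ℝ := fun i => min (y i) (1 - ε)
  have h1 : volume (Set.Icc u fun i => u i + ε) = ENNReal.ofReal (ε ^ d) := by
    rw [Real.volume_Icc_pi]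
    simp [ENNReal.ofReal_pow hε0.le]
  rw [← h1]
  refine measure_mono fun z hz => ⟨?_, fun i => ?_, fun i => ?_⟩
  · rw [Metric.mem_closedBall, dist_pi_le_iff hε0.le]
    intro i
    have h2 := hz.1 i
    have h3 := hz.2 i
    have h4 := hy.2 i
    simp only [u, Pi.one_apply] at h2 h3 h4
    rw [Real.dist_eq, abs_le]
    rcases min_choice (y i) (1 - ε) with h | h <;> rw [h] at h2 h3 <;>
      have := min_le_left (y i) (1 - ε) <;> constructor <;> linarith
  · refine le_trans ?_ (hz.1 i)
    exact le_min (hy.1 i) (by simpa using hε1)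
  · have h3 := hz.2 i
    have := min_le_right (y i) (1 - ε)
    simp only [u, Pi.one_apply] at h3 ⊢
    linarith

theorem exists_finite_net_Icc (d : ℕ) {ε : ℝ} (hε0 : 0 < ε) (hε1 : ε ≤ 1) :
    ∃ Y : Finset (Fin d → ℝ), (Y : Set (Fin d → ℝ)) ⊆ Set.Icc 0 1 ∧ (Y.card : ℝ) ≤ (3 / ε) ^ d ∧
      ∀ y ∈ Set.Icc (0 : Fin d → ℝ) 1, ∃ z ∈ Y, dist z y ≤ ε := by
  classical
  set m : ℕ := ⌈1 / ε⌉₊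
  have hm : 1 / ε ≤ m := Nat.le_ceil _
  have hm0 : (0 : ℝ) < m := lt_of_lt_of_le (by positivity) hm
  refine ⟨Finset.univ.image fun (v : Fin d → Fin (m + 1)) i => (v i : ℝ) / m, ?_, ?_, ?_⟩
  · intro y hy
    obtain ⟨v, -, rfl⟩ := Finset.mem_image.1 (Finset.mem_coe.1 hy)
    refine ⟨fun i => by simp; positivity, fun i => ?_⟩
    have : ((v i : ℕ) : ℝ) ≤ m := by exact_mod_cast Nat.lt_succ_iff.1 (v i).2
    simpa using div_le_one_of_le₀ this hm0.le
  · calc _ ≤ (((m + 1) ^ d : ℕ) : ℝ) := by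
          exact_mod_cast Finset.card_image_le.trans (by simp)
      _ ≤ _ := by
          push_cast
          gcongr
          have h1 : (m : ℝ) < 1 / ε + 1 := Nat.ceil_lt_add_one (by positivity)
          have h2 : 1 ≤ 1 / ε := (one_le_div hε0).2 hε1
          have h3 : 3 / ε = 3 * (1 / ε) := by ring
          linarith
  · intro y hy
    have hfl : ∀ i, ⌊y i * m⌋₊ < m + 1 := fun i => by
      have h1 : y i * m ≤ m := mul_le_of_le_one_left hm0.le (hy.2 i)
      exact Nat.lt_succ_iff.2 (Nat.floor_le_of_le h1)
    refine ⟨_, Finset.mem_image_of_mem _ (Finset.mem_univ fun i => ⟨⌊y i * m⌋₊, hfl i⟩), ?_⟩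
    refine (dist_pi_le_iff hε0.le).2 fun i => ?_
    have h0 : 0 ≤ y i * m := mul_nonneg (hy.1 i) hm0.le
    have h1 := Nat.floor_le h0
    have h2 := Nat.lt_floor_add_one (y i * m)
    have h3 : 1 / m ≤ ε := by rw [one_div_le hm0 hε0]; exact hm
    have h4 : ((⌊y i * m⌋₊ : ℝ)) / m ≤ y i := by rwa [div_le_iff₀ hm0]
    have h5 : y i < (⌊y i * m⌋₊ : ℝ) / m + 1 / m := by
      rw [← add_div, lt_div_iff₀ hm0]; exact h2
    rw [Real.dist_eq, abs_le]
    constructor <;> simp only <;> linarith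

section Covering

variable {d : ℕ} {Ω : Type*} [MeasurableSpace Ω] {P : Measure Ω} [IsProbabilityMeasure P]
  {X : ℕ → Ω → Fin d → ℝ}

theorem measure_forall_notMem_closedBall_le (hmeas : ∀ n, Measurable (X n)) (hindep : iIndepFun X P)
    (hlaw : ∀ n A, MeasurableSet A → P (X n ⁻¹' A) = volume (A ∩ Set.Icc 0 1))
    {ε : ℝ} (hε0 : 0 < ε) (hε1 : ε ≤ 1) {y : Fin d → ℝ} (hy : y ∈ Set.Icc (0 : Fin d → ℝ) 1)
    (I : Finset ℕ) :
    P {x | ∀ n ∈ I, X n x ∉ Metric.closedBall y ε} ≤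
      ENNReal.ofReal (Real.exp (-(ε ^ d * I.card))) := by
  have hball : MeasurableSet (Metric.closedBall y ε) := Metric.isClosed_closedBall.measurableSet
  have hset : {x | ∀ n ∈ I, X n x ∉ Metric.closedBall y ε} =
      ⋂ n ∈ I, X n ⁻¹' (Metric.closedBall y ε)ᶜ := by
    ext x
    simp
  rw [hset, hindep.measure_inter_preimage_eq_mul I fun _ _ => hball.compl]
  have hone : ∀ n ∈ I, P (X n ⁻¹' (Metric.closedBall y ε)ᶜ) ≤
      ENNReal.ofReal (Real.exp (-ε ^ d)) := by
    intro n _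
    rw [Set.preimage_compl, prob_compl_eq_one_sub (hmeas n hball), hlaw n _ hball]
    calc _ ≤ 1 - ENNReal.ofReal (ε ^ d) :=
          tsub_le_tsub_left (ofReal_pow_le_volume_closedBall_inter hε0 hε1 hy) _
      _ = ENNReal.ofReal (1 - ε ^ d) := by
          rw [ENNReal.ofReal_sub _ (by positivity), ENNReal.ofReal_one]
      _ ≤ _ := ENNReal.ofReal_le_ofReal (by linarith [Real.add_one_le_exp (-ε ^ d)])
  refine (Finset.prod_le_prod' hone).trans_eq ?_
  rw [Finset.prod_const, ← ENNReal.ofReal_pow (Real.exp_pos _).le, ← Real.exp_nat_mul]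
  ring_nf

/-- Union bound over an `ε`-net: a centre within `ε` of every net point is within `2 * ε` of every
point. -/
theorem measure_not_dense_le (hmeas : ∀ n, Measurable (X n)) (hindep : iIndepFun X P)
    (hlaw : ∀ n A, MeasurableSet A → P (X n ⁻¹' A) = volume (A ∩ Set.Icc 0 1))
    {ε : ℝ} (hε0 : 0 < ε) (hε1 : ε ≤ 1) (I : Finset ℕ) :
    P {x | ¬ ∀ y ∈ Set.Icc (0 : Fin d → ℝ) 1, ∃ n ∈ I, dist (X n x) y ≤ 2 * ε} ≤
      ENNReal.ofReal ((3 / ε) ^ d * Real.exp (-(ε ^ d * I.card))) := by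
  obtain ⟨Y, hY, hYc, hYnet⟩ := exists_finite_net_Icc d hε0 hε1
  calc _ ≤ P (⋃ z ∈ Y, {x | ∀ n ∈ I, X n x ∉ Metric.closedBall z ε}) := by
        refine measure_mono fun x hx => ?_
        by_contra hcon
        refine hx fun y hy => ?_
        obtain ⟨z, hz, hzy⟩ := hYnet y hy
        simp only [Set.mem_iUnion, Set.mem_ofPred_eq, not_exists, not_forall, not_not] at hcon
        obtain ⟨n, hn, hnz⟩ := hcon z hz
        refine ⟨n, hn, (dist_triangle _ z _).trans ?_⟩
        rw [Metric.mem_closedBall] at hnz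
        linarith
    _ ≤ ∑ z ∈ Y, P {x | ∀ n ∈ I, X n x ∉ Metric.closedBall z ε} := measure_biUnion_finset_le _ _
    _ ≤ ∑ z ∈ Y, ENNReal.ofReal (Real.exp (-(ε ^ d * I.card))) := Finset.sum_le_sum fun z hz =>
        measure_forall_notMem_closedBall_le hmeas hindep hlaw hε0 hε1 (hY hz) I
    _ ≤ _ := by
        rw [Finset.sum_const, nsmul_eq_mul, ← ENNReal.ofReal_natCast,
          ← ENNReal.ofReal_mul (by positivity)]
        gcongr

theorem tendsto_rpow_neg_mul_exp_neg {C D p q : ℝ} (hC : 0 < C) (hp : 0 < p) :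
    Tendsto (fun R : ℝ => D * R ^ (-q) * Real.exp (-(C * R ^ (-p)))) (nhdsWithin 0 (Set.Ioi 0))
      (nhds 0) := by
  have h1 := (tendsto_rpow_mul_exp_neg_mul_atTop_nhds_zero (q / p) C hC).comp
    ((tendsto_rpow_atTop hp).comp tendsto_inv_nhdsGT_zero) |>.const_mul D
  rw [mul_zero] at h1
  refine h1.congr' ?_
  filter_upwards [self_mem_nhdsWithin] with R (hR : 0 < R)
  simp only [Function.comp_apply]
  rw [← Real.rpow_mul (by positivity), mul_div_cancel₀ _ hp.ne', Real.inv_rpow hR.le,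
    Real.inv_rpow hR.le, ← Real.rpow_neg hR.le, ← Real.rpow_neg hR.le, mul_assoc, neg_mul]

/-- Almost surely, at arbitrarily small scales `R` the points whose radius exceeds `R` are
`o(R ^ θ)`-dense in the cube, provided that `∑ ρ n ^ t` diverges for some `t > d * θ`. -/
theorem ae_forall_exists_scale (hmeas : ∀ n, Measurable (X n)) (hindep : iIndepFun X P)
    (hlaw : ∀ n A, MeasurableSet A → P (X n ⁻¹' A) = volume (A ∩ Set.Icc 0 1))
    {ρ : ℕ → ℝ} (hρ : ∀ n, 0 < ρ n) {θ t : ℝ} (hθ : 0 < θ) (hθt : d * θ < t)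
    (hsum : ¬ Summable fun n => ρ n ^ t) :
    ∀ᵐ x ∂P, ∀ k : ℕ, ∃ R : ℝ, 0 < R ∧ R < 1 / (k + 1) ∧ ∀ y ∈ Set.Icc (0 : Fin d → ℝ) 1,
      ∃ n, k ≤ n ∧ R < ρ n ∧ dist (X n x) y ≤ R ^ θ / (k + 1) := by
  rw [ae_all_iff]
  intro k
  obtain ⟨t', ht', ht't⟩ := exists_between hθt
  have ht'0 : 0 < t' := lt_of_le_of_lt (by positivity) ht'
  have hR : Tendsto (fun j : ℕ => (1 / 2 : ℝ) ^ j) atTop (nhdsWithin 0 (Set.Ioi 0)) :=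
    tendsto_pow_atTop_nhdsWithin_zero_of_lt_one (by norm_num) (by norm_num)
  -- With `ε = R ^ θ / c`, the resolution `2 * ε` is exactly `R ^ θ / (k + 1)`.
  set c : ℝ := 2 * (k + 1)
  have hc : 0 < c := by positivity
  have hlim := ENNReal.tendsto_ofReal <| (tendsto_rpow_neg_mul_exp_neg (C := (c ^ d)⁻¹)
    (D := (3 * c) ^ d) (p := t' - d * θ) (q := d * θ) (by positivity) (by linarith)).comp hR
  rw [ENNReal.ofReal_zero] at hlim
  -- For fixed `k`, the event that no scale works lies in the failure event of each good dyadic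
  -- scale. Those have probability tending to 0 because `ε ^ d * I.card` is at least a constant
  -- times `R ^ (-(t' - d * θ))`; no Borel–Cantelli argument is needed.
  refine le_antisymm (ge_of_tendsto_of_frequently hlim ?_) zero_le
  have hsmall := hR.eventually (Ioo_mem_nhdsGT (show (0 : ℝ) < 1 / (k + 1) by positivity))
  refine ((frequently_rpow_le_card_of_not_summable hρ ht'0 ht't hsum k).and_eventually
    hsmall).mono ?_
  rintro j ⟨⟨I, hI, hIc⟩, hj0, hj1⟩
  set R : ℝ := (1 / 2) ^ j
  have hR1 : R ≤ 1 := pow_le_one₀ (by norm_num) (by norm_num)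
  have hε1 : R ^ θ / c ≤ 1 := by
    refine div_le_one_of_le₀ ((Real.rpow_le_one hj0.le hR1 hθ.le).trans ?_) hc.le
    have : (0 : ℝ) ≤ k := k.cast_nonneg
    simp only [c]
    linarith
  refine (measure_mono ?_).trans ((measure_not_dense_le hmeas hindep hlaw
    (ε := R ^ θ / c) (by positivity) hε1 I).trans ?_)
  · intro x hx hdense
    refine hx ⟨R, hj0, hj1, fun y hy => ?_⟩
    obtain ⟨n, hn, hny⟩ := hdense y hy
    refine ⟨n, (hI n hn).1, (hI n hn).2, hny.trans_eq ?_⟩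
    simp only [c]
    field_simp
  · refine ENNReal.ofReal_le_ofReal ?_
    have h1 : (R ^ θ) ^ d = R ^ (d * θ) := by
      rw [← Real.rpow_natCast, ← Real.rpow_mul hj0.le, mul_comm]
    have h2 : (3 / (R ^ θ / c)) ^ d = (3 * c) ^ d * R ^ (-(d * θ)) := by
      rw [div_div_eq_mul_div, div_pow, h1, Real.rpow_neg hj0.le, div_eq_mul_inv]
    have h3 : (c ^ d)⁻¹ * R ^ (-(t' - d * θ)) = (R ^ θ / c) ^ d * R ^ (-t') := by
      rw [div_pow, h1, neg_sub, sub_eq_add_neg, Real.rpow_add hj0]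
      ring
    simp only [Function.comp_apply]
    rw [h2, h3]
    gcongr

end Covering

/-! ### Transfer to the Euclidean norm and conclusion. -/

theorem ofLp_preimage_Icc (d : ℕ) :
    (WithLp.ofLp : EuclideanSpace ℝ (Fin d) → Fin d → ℝ) ⁻¹' Set.Icc 0 1 = unitCube d := by
  ext x
  simp [unitCube, Set.mem_Icc, Pi.le_def, forall_and]

theorem volume_unitCube (d : ℕ) : volume (unitCube d) = 1 := by
  rw [← ofLp_preimage_Icc, (PiLp.volume_preserving_ofLp (Fin d)).measure_preimage
    measurableSet_Icc.nullMeasurableSet, Real.volume_Icc_pi]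
  simp

theorem not_summable_rpow_of_lt_convergenceExponent {r : ℕ → ℝ} {t : ℝ≥0}
    (ht : t < convergenceExponent r) : ¬ Summable fun n => r n ^ (t : ℝ) :=
  fun h => not_le.2 ht (iInf₂_le t h)

/-- A sup-norm ball of radius `r n / K` sits inside the Euclidean ball of radius `r n`, and the
linear identification preserves dimension. Dividing radii by `K` does not affect summability of
their powers. -/
theorem dimH_limsupBalls_ofLp_inter_le {d : ℕ} (r : ℕ → ℝ) {K : ℝ} (hK : 0 < K)
    (hKle : ∀ v : EuclideanSpace ℝ (Fin d), ‖v‖ ≤ K * ‖v.ofLp‖)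
    (c : ℕ → EuclideanSpace ℝ (Fin d)) :
    dimH (limsupBalls (fun n => (c n).ofLp) (fun n => r n / K) ∩ Set.Icc 0 1) ≤
      dimH (limsupBalls c r ∩ unitCube d) := by
  rw [← (EuclideanSpace.equiv (Fin d) ℝ).dimH_preimage]
  refine dimH_mono fun x hx => ⟨mem_limsupBalls.2 ((mem_limsupBalls.1 hx.1).mono fun n hn => ?_), ?_⟩
  · rw [lt_div_iff₀' hK] at hn
    rw [dist_eq_norm]
    refine (hKle _).trans_lt (lt_of_eq_of_lt ?_ hn)
    rw [dist_eq_norm]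
    rfl
  · rw [← ofLp_preimage_Icc]
    exact hx.2

theorem ae_ofReal_le_dimH_limsupBalls_inter {d : ℕ} {r : ℕ → ℝ} (hr : ∀ n, 0 < r n)
    {Ω : Type*} [MeasurableSpace Ω] {P : Measure Ω} [IsProbabilityMeasure P]
    {ω : ℕ → Ω → EuclideanSpace ℝ (Fin d)}
    (hmeas : ∀ n, Measurable (ω n)) (hindep : iIndepFun ω P)
    (hunif : ∀ n, pdf.IsUniform (ω n) (unitCube d) P volume) {θ : ℝ} (hθ0 : 0 < θ) (hθ1 : θ < 1)
    (hθ : ENNReal.ofReal (d * θ) < convergenceExponent r) :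
    ∀ᵐ x ∂P, ENNReal.ofReal (d * θ) ≤ dimH (limsupBalls (fun n => ω n x) r ∩ unitCube d) := by
  obtain ⟨t, ht1, ht2⟩ := ENNReal.lt_iff_exists_nnreal_btwn.1 hθ
  have hdt : d * θ < t := by
    rwa [← ENNReal.ofReal_coe_nnreal, ENNReal.ofReal_lt_ofReal_iff_of_nonneg (by positivity)] at ht1
  have ht : ¬ Summable fun n => r n ^ (t : ℝ) := not_summable_rpow_of_lt_convergenceExponent ht2
  obtain ⟨K, hK, hKle⟩ : ∃ K : ℝ, 0 < K ∧
      ∀ v : EuclideanSpace ℝ (Fin d), ‖v‖ ≤ K * ‖v.ofLp‖ := by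
    set e := ((EuclideanSpace.equiv (Fin d) ℝ).symm : (Fin d → ℝ) →L[ℝ] EuclideanSpace ℝ (Fin d))
    refine ⟨‖e‖ + 1, by positivity, fun v => (e.le_opNorm v.ofLp).trans ?_⟩
    gcongr
    linarith
  have hofLp : Measurable (WithLp.ofLp : EuclideanSpace ℝ (Fin d) → Fin d → ℝ) :=
    (PiLp.volume_preserving_ofLp (Fin d)).measurable
  have hlaw : ∀ n A, MeasurableSet A → P ((fun x => (ω n x).ofLp) ⁻¹' A) =
      volume (A ∩ Set.Icc (0 : Fin d → ℝ) 1) := by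
    intro n A hA
    have h1 := (hunif n).measure_preimage (by simp [volume_unitCube]) (by simp [volume_unitCube])
      (hofLp hA)
    rw [volume_unitCube, div_one, ← ofLp_preimage_Icc, Set.inter_comm, ← Set.preimage_inter,
      (PiLp.volume_preserving_ofLp (Fin d)).measure_preimage
        (hA.inter measurableSet_Icc).nullMeasurableSet] at h1
    exact h1
  have hsum : ¬ Summable fun n => (r n / K) ^ (t : ℝ) := by
    simp_rw [Real.div_rpow (hr _).le hK.le, div_eq_mul_inv]
    rwa [summable_mul_right_iff (by positivity)]
  filter_upwards [ae_forall_exists_scale (fun n => hofLp.comp (hmeas n))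
    (hindep.comp (fun _ => WithLp.ofLp) fun _ => hofLp) hlaw (fun n => div_pos (hr n) hK)
    hθ0 hdt hsum] with x hx
  exact (le_dimH_limsupBalls_inter hθ0 hθ1 hx).trans (dimH_limsupBalls_ofLp_inter_le r hK hKle _)

/-- Almost surely, the limsup set `E` of the balls with centres `ω n` and radii `r n` has Hausdorff
dimension `min t₀ d`, whether the balls are taken in `ℝ^d` or in the cube `[0, 1]^d`. -/
theorem theorem1 (d : ℕ) (r : ℕ → ℝ) (hr : ∀ n, 0 < r n)
    {Ω : Type*} [MeasurableSpace Ω] (P : Measure Ω) [IsProbabilityMeasure P]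
    (ω : ℕ → Ω → EuclideanSpace ℝ (Fin d))
    (hmeas : ∀ n, Measurable (ω n))
    (hindep : iIndepFun ω P)
    (hunif : ∀ n, pdf.IsUniform (ω n) (unitCube d) P volume) :
    ∀ᵐ x ∂P,
      dimH (limsupBalls (fun n => ω n x) r) = min (convergenceExponent r) (d : ℝ≥0∞) ∧
      dimH (limsupBalls (fun n => ω n x) r ∩ unitCube d) =
        min (convergenceExponent r) (d : ℝ≥0∞) := by
  -- Rational `θ` gives one null set for all exponents.
  have hrat : ∀ᵐ x ∂P, ∀ q : ℚ, 0 < (q : ℝ) → (q : ℝ) < 1 →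
      ENNReal.ofReal (d * q) < convergenceExponent r →
      ENNReal.ofReal (d * q) ≤ dimH (limsupBalls (fun n => ω n x) r ∩ unitCube d) := by
    simp only [ae_all_iff, eventually_imp_distrib_left]
    exact fun q h0 h1 hq => ae_ofReal_le_dimH_limsupBalls_inter hr hmeas hindep hunif h0 h1 hq
  filter_upwards [hrat] with x hx
  have hupper : dimH (limsupBalls (fun n => ω n x) r) ≤ min (convergenceExponent r) d := by
    refine le_min (dimH_limsupBalls_le_convergenceExponent _ hr) ?_
    refine (dimH_mono (Set.subset_univ _)).trans_eq ?_
    rw [Real.dimH_univ_eq_finrank]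
    simp
  have hmono : dimH (limsupBalls (fun n => ω n x) r ∩ unitCube d) ≤
      dimH (limsupBalls (fun n => ω n x) r) := dimH_mono Set.inter_subset_left
  have hlower : min (convergenceExponent r) d ≤
      dimH (limsupBalls (fun n => ω n x) r ∩ unitCube d) := by
    refine le_of_forall_lt fun b hb => ?_
    obtain ⟨s, hbs, hs⟩ := ENNReal.lt_iff_exists_nnreal_btwn.1 hb
    obtain ⟨u, hsu, hu⟩ := ENNReal.lt_iff_exists_nnreal_btwn.1 hs
    have hsu' : (s : ℝ) < u := by exact_mod_cast hsu
    have hud : (u : ℝ) < d := by exact_mod_cast hu.trans_le (min_le_right _ _)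
    have hd : (0 : ℝ) < d := u.coe_nonneg.trans_lt hud
    obtain ⟨q, hq1, hq2⟩ := exists_rat_btwn (div_lt_div_of_pos_right hsu' hd)
    have hsq : (s : ℝ) < d * q := by rwa [div_lt_iff₀' hd] at hq1
    have hqu : d * q < (u : ℝ) := by rwa [lt_div_iff₀' hd] at hq2
    have hq0 : (0 : ℝ) < q := lt_of_le_of_lt (by positivity) hq1
    refine hbs.trans_le (le_trans ?_ (hx q hq0 (hq2.trans ((div_lt_one hd).2 hud)) ?_))
    · rw [← ENNReal.ofReal_coe_nnreal]
      exact ENNReal.ofReal_le_ofReal hsq.le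
    · refine lt_of_lt_of_le ?_ (hu.le.trans (min_le_left _ _))
      rw [← ENNReal.ofReal_coe_nnreal]
      exact (ENNReal.ofReal_lt_ofReal_iff_of_nonneg (by positivity)).2 hqu
  exact ⟨le_antisymm hupper (hlower.trans hmono), le_antisymm (hmono.trans hupper) hlower⟩
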